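/- **Existence of a user equilibrium for pedestrian traffic assignment with the stochastic symmetric travel-time function.** Let a footpath network be a finite graph without loops, with node set $N$, in which every link $a=(i,j)\in A$ has its opposite link $a'=(j,i)\in A$. Each link has a capacity $c_a>0$ and a free-flow travel time $\tau_a>0$, with $c_{a'}=c_a$ and $\tau_{a'}=\tau_a$. Let $q_{rs}\ge 0$ be given demands for $r,s\in N$, put $W=\{(r,s): q_{rs}>0\}$, let $\Pi_{rs}$ be the set of (simple) paths from $r$ to $s$, and assume $\Pi_{rs}\neq\emptyset$ for every $(r,s)\in W$. Let $\delta_{a,k}=1$ if the link $a$ is on the path $k$ and $\delta_{a,k}=0$ otherwise. Path flows $f=(f_k^{rs})_{(r,s)\in W,\,k\in\Pi_{rs}}$ are feasible if $f_k^{rs}\ge 0$ and $\sum_{k\in\Pi_{rs}}f_k^{rs}=q_{rs}$ for all $(r,s)\in W$; they induce the link flows $x_a=\sum_{(r,s)\in W}\sum_{k\in\Pi_{rs}}\delta_{a,k}f_k^{rs}$. Let $\Omega$ be the set of all link flow vectors $x=(x_a)_{a\in A}$ induced by feasible path flows. Fix $\alpha,\beta,\phi>0$ and $\gamma,\lambda_t\in\mathbb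 R$, and for $x,y\ge 0$ put $$t_a(x,y)=\tau_a\Bigl(1+\alpha\Bigl(\frac{x+y}{c_a}\Bigr)^{\beta}\Bigr),\qquad \sigma_a(x,y)=\tau_a\,\phi\,e^{\gamma\left(\frac{x+y}{c_a}-\lambda_t\right)^2}.$$ Let the random travel time $T_a(x,y)$ of link $a$ (with own flow $x$ and flow $y$ on the opposite link) be log-normally distributed with mean $t_a(x,y)$ and standard deviation $\sigma_a(x,y)$; the joint distribution of the travel times of different links is arbitrary. Assume that every $t_a$ is continuous on $[0,\infty)^2$ and twice continuously differentiable on $(0,\infty)^2$. Then at least one UE-pTAP solution exists: there are feasible path flows $f$ whose link flow vector $x^*\in\Omega$ solves the variational inequality $$\sum_{a\in A}\mathbb E\bigl[T_a(x^*_a,x^*_{a'})\bigr]\,(x_a-x_a^*)\ \ge\ 0\qquad\text{for all } x\in\Omega,$$ and which satisfy Wardrop's first principle with respect to expected travel times: for all $(r,s)\in W$ and $k,k'\in\Pi_{rs}$ with $f^{rs}_k>0$, $$\mathbb E\Bigl[\sum_{a\in A}\delta_{a,k}T_a(x^*_a,x^*_{a'})\Bigr]\le \mathbb E\Bigl[\sum_{a\in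 A}\delta_{a,k'}T_a(x^*_a,x^*_{a'})\Bigr].$$ -/

import Mathlib

open MeasureTheory ProbabilityTheory
open scoped NNReal

noncomputable section

namespace PTAP

/-- The log-normal distribution with mean `m > 0` and standard deviation `s`: the law of `exp Z`,
where `Z` is Gaussian with variance `v = log (1 + s² / m²)` and mean `log m - v / 2`. -/
def logNormal (m s : ℝ) : Measure ℝ :=
  (gaussianReal (Real.log m - Real.log (1 + s ^ 2 / m ^ 2) / 2)
    (Real.log (1 + s ^ 2 / m ^ 2)).toNNReal).map Real.exp

/-- Check of the parametrisation: `logNormal m s` has mean `m`. -/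
theorem integral_logNormal {m : ℝ} (hm : 0 < m) (s : ℝ) : ∫ y, y ∂(logNormal m s) = m := by
  have hv : 0 ≤ Real.log (1 + s ^ 2 / m ^ 2) := Real.log_nonneg (by
    have : 0 ≤ s ^ 2 / m ^ 2 := by positivity
    linarith)
  have h := congrFun (mgf_id_gaussianReal
    (μ := Real.log m - Real.log (1 + s ^ 2 / m ^ 2) / 2)
    (v := (Real.log (1 + s ^ 2 / m ^ 2)).toNNReal)) 1
  simp only [mgf, id, one_mul, mul_one, one_pow, Real.coe_toNNReal _ hv, sub_add_cancel,
    Real.exp_log hm] at h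
  rw [logNormal, integral_map Real.measurable_exp.aemeasurable
    (f := fun y : ℝ => y) (by fun_prop)]
  exact h

/-- The second moment of `logNormal m s` is `m² + s²`, so that its variance is `s²`. -/
theorem integral_sq_logNormal {m : ℝ} (hm : 0 < m) (s : ℝ) :
    ∫ y, y ^ 2 ∂(logNormal m s) = m ^ 2 + s ^ 2 := by
  have h0 : 0 ≤ s ^ 2 / m ^ 2 := by positivity
  have hv : 0 ≤ Real.log (1 + s ^ 2 / m ^ 2) := Real.log_nonneg (by linarith)
  have h := congrFun (mgf_id_gaussianReal
    (μ := Real.log m - Real.log (1 + s ^ 2 / m ^ 2) / 2)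
    (v := (Real.log (1 + s ^ 2 / m ^ 2)).toNNReal)) 2
  simp only [mgf, id, Real.coe_toNNReal _ hv] at h
  rw [logNormal, integral_map Real.measurable_exp.aemeasurable
    (f := fun y : ℝ => y ^ 2) (by fun_prop)]
  have e : ∀ x : ℝ, Real.exp x ^ 2 = Real.exp (2 * x) := fun x => by
    rw [← Real.exp_nat_mul]; norm_num
  simp only [e]
  rw [h]
  have : (Real.log m - Real.log (1 + s ^ 2 / m ^ 2) / 2) * 2 +
      Real.log (1 + s ^ 2 / m ^ 2) * 2 ^ 2 / 2 =
      Real.log m + Real.log m + Real.log (1 + s ^ 2 / m ^ 2) := by ring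
  rw [this, Real.exp_add, Real.exp_add, Real.exp_log hm, Real.exp_log (by linarith)]
  field_simp

/-- A footpath network with fixed demand. Every footpath is walked in both directions, so the
network is a simple graph `G`; a link `a = (i, j)` is a dart of `G`, and `a.symm = (j, i)` is the
other link of its bidirectional stream. The two links of a stream have the same capacity and the
same free-flow travel time. -/
structure Network {V : Type*} (G : SimpleGraph V) where
  /-- capacity `c_a` -/
  capacity : G.Dart → ℝ
  /-- free-flow travel time `τ_a` -/
  freeFlow : G.Dart → ℝ
  /-- travel demand `q_rs` -/
  demand : V → V → ℝ
  capacity_pos : ∀ a, 0 < capacity a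
  freeFlow_pos : ∀ a, 0 < freeFlow a
  capacity_symm : ∀ a, capacity a.symm = capacity a
  freeFlow_symm : ∀ a, freeFlow a.symm = freeFlow a
  demand_nonneg : ∀ r s, 0 ≤ demand r s

/-- The parameters of the stochastic symmetric pVDF. -/
structure Params where
  α : ℝ
  β : ℝ
  φ : ℝ
  γ : ℝ
  lam : ℝ
  α_pos : 0 < α
  β_pos : 0 < β
  φ_pos : 0 < φ

variable {V : Type*} {G : SimpleGraph V}

/-- The mean travel time `t_a(x, y)` of link `a` when its own flow is `x` and the flow on the
opposite link is `y`. -/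
def meanTime (𝒩 : Network G) (θ : Params) (a : G.Dart) (x y : ℝ) : ℝ :=
  𝒩.freeFlow a * (1 + θ.α * ((x + y) / 𝒩.capacity a) ^ θ.β)

/-- The standard deviation `σ_a(x, y)` of the travel time of link `a`. -/
def stdDev (𝒩 : Network G) (θ : Params) (a : G.Dart) (x y : ℝ) : ℝ :=
  𝒩.freeFlow a * θ.φ * Real.exp (θ.γ * ((x + y) / 𝒩.capacity a - θ.lam) ^ 2)

/-- The random link travel times `T a x y` (own flow `x`, opposite flow `y`) follow the stochastic
symmetric pVDF. Nothing is required of the joint law of different links. -/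
def IsStochasticSymmetricPVDF (𝒩 : Network G) (θ : Params) {S : Type*} [MeasurableSpace S]
    (P : Measure S) (T : G.Dart → ℝ → ℝ → S → ℝ) : Prop :=
  ∀ a x y, 0 ≤ x → 0 ≤ y →
    HasLaw (T a x y) (logNormal (meanTime 𝒩 θ a x y) (stdDev 𝒩 θ a x y)) P

section Flows

variable [Fintype V] [DecidableEq V] [DecidableRel G.Adj]

/-- The link-path incidence number: `1` if link `a` is on the path `p`, else `0`. -/
def incidence {r s : V} (a : G.Dart) (p : G.Path r s) : ℝ :=
  if a ∈ (p : G.Walk r s).darts then 1 else 0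

/-- The set `W` of origin-destination pairs, those with positive demand. -/
def odPairs (𝒩 : Network G) : Set (V × V) := {w | 0 < 𝒩.demand w.1 w.2}

open Classical in
/-- The link flows induced by path flows `f`. -/
def linkFlow (𝒩 : Network G) (f : ∀ r s : V, G.Path r s → ℝ) (a : G.Dart) : ℝ :=
  ∑ w : V × V with w ∈ odPairs 𝒩, ∑ p : G.Path w.1 w.2, incidence a p * f w.1 w.2 p

/-- The path flows `f` are nonnegative and carry the demand of every origin-destination pair. -/
def IsFeasiblePathFlow (𝒩 : Network G) (f : ∀ r s : V, G.Path r s → ℝ) : Prop :=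
  ∀ r s, (r, s) ∈ odPairs 𝒩 → (∀ p, 0 ≤ f r s p) ∧ ∑ p, f r s p = 𝒩.demand r s

/-- The set `Ω` of feasible link flows. -/
def feasibleLinkFlows (𝒩 : Network G) : Set (G.Dart → ℝ) :=
  {x | (∀ a, 0 ≤ x a) ∧ ∃ f, IsFeasiblePathFlow 𝒩 f ∧ x = linkFlow 𝒩 f}

/-- The expected travel time of link `a` under the link flows `x`. -/
def expectedTime {S : Type*} [MeasurableSpace S] (P : Measure S)
    (T : G.Dart → ℝ → ℝ → S → ℝ) (x : G.Dart → ℝ) (a : G.Dart) : ℝ :=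
  ∫ ω, T a (x a) (x a.symm) ω ∂P

/-- The expected travel time of the path `p` under the link flows `x`. -/
def expectedPathTime {S : Type*} [MeasurableSpace S] (P : Measure S)
    (T : G.Dart → ℝ → ℝ → S → ℝ) (x : G.Dart → ℝ) {r s : V} (p : G.Path r s) : ℝ :=
  ∫ ω, ∑ a : G.Dart, incidence a p * T a (x a) (x a.symm) ω ∂P

/-- `x` solves the variational inequality of the UE-pTAP:
`x ∈ Ω` and `t(x)ᵀ (z - x) ≥ 0` for all `z ∈ Ω`. -/
def SolvesVI (𝒩 : Network G) {S : Type*} [MeasurableSpace S] (P : Measure S)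
    (T : G.Dart → ℝ → ℝ → S → ℝ) (x : G.Dart → ℝ) : Prop :=
  x ∈ feasibleLinkFlows 𝒩 ∧
    ∀ z ∈ feasibleLinkFlows 𝒩, 0 ≤ ∑ a, expectedTime P T x a * (z a - x a)

/-- Wardrop's first principle: no used path of an origin-destination pair has a larger expected
travel time than another path of the same pair. -/
def IsWardropEquilibrium (𝒩 : Network G) {S : Type*} [MeasurableSpace S] (P : Measure S)
    (T : G.Dart → ℝ → ℝ → S → ℝ) (f : ∀ r s : V, G.Path r s → ℝ) : Prop :=
  IsFeasiblePathFlow 𝒩 f ∧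
    ∀ r s, (r, s) ∈ odPairs 𝒩 → ∀ p p' : G.Path r s, 0 < f r s p →
      expectedPathTime P T (linkFlow 𝒩 f) p ≤ expectedPathTime P T (linkFlow 𝒩 f) p'

end Flows

end PTAP

end

/-!
The mean travel time of a link depends on the two flows of its stream only through their sum, and
the two links of a stream have the same mean travel time function `tₐ` of that sum. The mean travel
times are therefore the gradient of a Beckmann potential,
`Z(x) = ½ ∑ₐ ∫₀^{xₐ + xₐ'} tₐ` (`hasDerivAt_beckmann_line`).

The path flows that carry exactly the demand of every pair of nodes form a compact convex set
(`pathFlows`), nonempty because every origin-destination pair is connected. The potential of the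
induced link flows attains its minimum there, and the first-order condition at a minimiser `f` is
the variational inequality (`exists_variationalInequality`). Wardrop's principle follows by testing
the inequality with the link flows obtained from `f` by moving the whole flow on a used path `p` to
another path `p'` of the same pair: the left-hand side becomes `f_p` times the difference of the
two path times (`pathTime_le_of_variationalInequality`). Log-normal laws enter only through their
mean, which is positive, so that the link travel times are integrable and expectations of path
times are sums of expectations of link times.
-/

namespace PTAP

/-! ### The Beckmann potential -/

section Potential

variable {V : Type*} {G : SimpleGraph V}

/-- The primitive `∫₀ᵘ t_a` of the mean travel time of link `a` as a function of the total flow `u`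
of its stream, in closed form. -/
noncomputable def meanTimePrimitive (𝒩 : Network G) (θ : Params) (a : G.Dart) (u : ℝ) : ℝ :=
  𝒩.freeFlow a * (u + θ.α * 𝒩.capacity a / (θ.β + 1) * (u / 𝒩.capacity a) ^ (θ.β + 1))

/-- The derivative exists at every real `u`, also at `u ≤ 0`, since `θ.β + 1 ≥ 1`. -/
theorem hasDerivAt_meanTimePrimitive (𝒩 : Network G) (θ : Params) (a : G.Dart) (x y : ℝ) :
    HasDerivAt (meanTimePrimitive 𝒩 θ a) (meanTime 𝒩 θ a x y) (x + y) := by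
  have hc := (𝒩.capacity_pos a).ne'
  have hβ : θ.β + 1 ≠ 0 := by linarith [θ.β_pos]
  have h1 : HasDerivAt (fun u : ℝ => u / 𝒩.capacity a) (1 / 𝒩.capacity a) (x + y) :=
    (hasDerivAt_id _).div_const _
  have h2 := h1.rpow_const (p := θ.β + 1) (Or.inr (by linarith [θ.β_pos]))
  have h3 := ((hasDerivAt_id (x + y)).add
    (h2.const_mul (θ.α * 𝒩.capacity a / (θ.β + 1)))).const_mul (𝒩.freeFlow a)
  refine h3.congr_deriv ?_
  rw [add_sub_cancel_right, meanTime]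
  field_simp

theorem meanTime_symm (𝒩 : Network G) (θ : Params) (a : G.Dart) (x y : ℝ) :
    meanTime 𝒩 θ a.symm y x = meanTime 𝒩 θ a x y := by
  simp only [meanTime, 𝒩.capacity_symm, 𝒩.freeFlow_symm, add_comm y x]

theorem meanTime_pos (𝒩 : Network G) (θ : Params) (a : G.Dart) {x y : ℝ}
    (hx : 0 ≤ x) (hy : 0 ≤ y) : 0 < meanTime 𝒩 θ a x y := by
  have := 𝒩.capacity_pos a
  have := 𝒩.freeFlow_pos a
  have := θ.α_pos
  unfold meanTime
  positivity

variable [Fintype V] [DecidableRel G.Adj]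

/-- The Beckmann potential of the link flows `x`. The sum runs over links, so every bidirectional
stream occurs twice; the factor `1 / 2` compensates for this. -/
noncomputable def beckmann (𝒩 : Network G) (θ : Params) (x : G.Dart → ℝ) : ℝ :=
  ∑ a, 1 / 2 * meanTimePrimitive 𝒩 θ a (x a + x a.symm)

theorem continuous_beckmann (𝒩 : Network G) (θ : Params) : Continuous (beckmann 𝒩 θ) := by
  have h : ∀ a, Continuous (meanTimePrimitive 𝒩 θ a) := fun a =>
    continuous_iff_continuousAt.2 fun u => by
      simpa using (hasDerivAt_meanTimePrimitive 𝒩 θ a u 0).continuousAt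
  unfold beckmann
  fun_prop

/-- The mean travel times are the gradient of the Beckmann potential. -/
theorem hasDerivAt_beckmann_line (𝒩 : Network G) (θ : Params) (x d : G.Dart → ℝ) :
    HasDerivAt (fun ε : ℝ => beckmann 𝒩 θ (x + ε • d))
      (∑ a, meanTime 𝒩 θ a (x a) (x a.symm) * d a) 0 := by
  have hline : ∀ a : G.Dart, HasDerivAt
      (fun ε : ℝ => (x + ε • d) a + (x + ε • d) a.symm) (d a + d a.symm) 0 := fun a => by
    have h := ((hasDerivAt_id (0 : ℝ)).mul_const (d a + d a.symm)).const_add (x a + x a.symm)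
    rw [one_mul] at h
    refine h.congr_of_eventuallyEq (Filter.Eventually.of_forall fun ε => ?_)
    simp only [Pi.add_apply, Pi.smul_apply, smul_eq_mul, id]
    ring
  have hterm : ∀ a : G.Dart, HasDerivAt
      (fun ε : ℝ => 1 / 2 * meanTimePrimitive 𝒩 θ a ((x + ε • d) a + (x + ε • d) a.symm))
      (1 / 2 * (meanTime 𝒩 θ a (x a) (x a.symm) * (d a + d a.symm))) 0 := fun a => by
    refine HasDerivAt.const_mul _ (HasDerivAt.comp (h₂ := meanTimePrimitive 𝒩 θ a) 0 ?_ (hline a))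
    simpa using hasDerivAt_meanTimePrimitive 𝒩 θ a (x a) (x a.symm)
  refine (HasDerivAt.fun_sum fun a _ => hterm a).congr_deriv ?_
  -- Reversal of the links turns the terms with `d a.symm` into those with `d a`.
  have hsymm : ∑ a : G.Dart, meanTime 𝒩 θ a (x a) (x a.symm) * d a.symm =
      ∑ a : G.Dart, meanTime 𝒩 θ a (x a) (x a.symm) * d a := by
    refine Fintype.sum_equiv SimpleGraph.Dart.symm_involutive.toPerm _ _ fun a => ?_
    rw [Function.Involutive.coe_toPerm, a.symm_symm, meanTime_symm]
  rw [← Finset.mul_sum]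
  simp only [mul_add, Finset.sum_add_distrib, hsymm]
  ring

end Potential

/-! ### Path flows and link flows -/

section PathFlows

variable {V : Type*} {G : SimpleGraph V} [DecidableEq V]

theorem incidence_nonneg {r s : V} (a : G.Dart) (p : G.Path r s) : 0 ≤ incidence a p := by
  unfold incidence
  split_ifs <;> norm_num

variable [Fintype V] [DecidableRel G.Adj]

/-- The path flows that are nonnegative and carry the demand of every pair of nodes. Unlike in
`IsFeasiblePathFlow`, flows between nodes without demand are forced to vanish, which makes the set
compact. -/
def pathFlows (𝒩 : Network G) : Set (∀ r s : V, G.Path r s → ℝ) :=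
  {f | ∀ r s, (∀ p, 0 ≤ f r s p) ∧ ∑ p, f r s p = 𝒩.demand r s}

theorem isFeasiblePathFlow_of_mem_pathFlows {𝒩 : Network G} {f : ∀ r s : V, G.Path r s → ℝ}
    (hf : f ∈ pathFlows 𝒩) : IsFeasiblePathFlow 𝒩 f :=
  fun r s _ => hf r s

theorem isCompact_pathFlows (𝒩 : Network G) : IsCompact (pathFlows 𝒩) := by
  refine (isCompact_Icc (a := 0) (b := fun r s _ => 𝒩.demand r s)).of_isClosed_subset ?_ ?_
  · simp only [pathFlows, Set.ofPred_forall, Set.ofPred_and]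
    refine isClosed_iInter fun r => isClosed_iInter fun s => IsClosed.inter ?_ ?_
    · exact isClosed_iInter fun p => isClosed_le continuous_const (by fun_prop)
    · exact isClosed_eq (by fun_prop) continuous_const
  · intro f hf
    refine ⟨fun r s p => (hf r s).1 p, fun r s p => ?_⟩
    refine le_of_le_of_eq ?_ (hf r s).2
    exact Finset.single_le_sum (fun q _ => (hf r s).1 q) (Finset.mem_univ p)

theorem convex_pathFlows (𝒩 : Network G) : Convex ℝ (pathFlows 𝒩) := by
  intro f hf g hg a b ha hb hab r s
  refine ⟨fun p => add_nonneg (mul_nonneg ha ((hf r s).1 p)) (mul_nonneg hb ((hg r s).1 p)), ?_⟩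
  simp only [Pi.add_apply, Pi.smul_apply, smul_eq_mul, Finset.sum_add_distrib, ← Finset.mul_sum,
    (hf r s).2, (hg r s).2, ← add_mul, hab, one_mul]

theorem pathFlows_nonempty (𝒩 : Network G)
    (hconn : ∀ r s, (r, s) ∈ odPairs 𝒩 → G.Reachable r s) : (pathFlows 𝒩).Nonempty := by
  have h : ∀ r s, ∃ g : G.Path r s → ℝ, (∀ p, 0 ≤ g p) ∧ ∑ p, g p = 𝒩.demand r s := by
    intro r s
    rcases (𝒩.demand_nonneg r s).lt_or_eq with h | h
    · obtain ⟨w⟩ := hconn r s h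
      refine ⟨Pi.single w.toPath (𝒩.demand r s), fun p => ?_, Fintype.sum_pi_single' _ _⟩
      exact (Pi.single_nonneg (α := fun _ => ℝ)).2 h.le p
    · exact ⟨0, fun _ => le_rfl, by simp [← h]⟩
  choose f hf using h
  exact ⟨f, hf⟩

theorem continuous_linkFlow (𝒩 : Network G) : Continuous (linkFlow 𝒩) := by
  refine continuous_pi fun a => ?_
  unfold linkFlow
  fun_prop

theorem linkFlow_add (𝒩 : Network G) (f g : ∀ r s : V, G.Path r s → ℝ) :
    linkFlow 𝒩 (f + g) = linkFlow 𝒩 f + linkFlow 𝒩 g := by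
  ext a
  simp only [linkFlow, Pi.add_apply, mul_add, Finset.sum_add_distrib]

theorem linkFlow_smul (𝒩 : Network G) (c : ℝ) (f : ∀ r s : V, G.Path r s → ℝ) :
    linkFlow 𝒩 (c • f) = c • linkFlow 𝒩 f := by
  ext a
  simp only [linkFlow, Pi.smul_apply, smul_eq_mul, Finset.mul_sum, mul_left_comm c]

theorem linkFlow_congr {𝒩 : Network G} {f g : ∀ r s : V, G.Path r s → ℝ}
    (h : ∀ r s, (r, s) ∈ odPairs 𝒩 → f r s = g r s) : linkFlow 𝒩 f = linkFlow 𝒩 g := by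
  classical
  ext a
  refine Finset.sum_congr rfl fun w hw => ?_
  rw [h w.1 w.2 (Finset.mem_filter.1 hw).2]

theorem linkFlow_nonneg {𝒩 : Network G} {f : ∀ r s : V, G.Path r s → ℝ}
    (hf : IsFeasiblePathFlow 𝒩 f) (a : G.Dart) : 0 ≤ linkFlow 𝒩 f a := by
  classical
  exact Finset.sum_nonneg fun w hw => Finset.sum_nonneg fun p _ =>
    mul_nonneg (incidence_nonneg a p) ((hf w.1 w.2 (Finset.mem_filter.1 hw).2).1 p)

theorem linkFlow_mem_feasibleLinkFlows {𝒩 : Network G} {f : ∀ r s : V, G.Path r s → ℝ}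
    (hf : IsFeasiblePathFlow 𝒩 f) : linkFlow 𝒩 f ∈ feasibleLinkFlows 𝒩 :=
  ⟨linkFlow_nonneg hf, f, hf, rfl⟩

/-- Flows between nodes without demand may be set to zero without changing the link flows. -/
theorem exists_mem_pathFlows_linkFlow_eq {𝒩 : Network G} {z : G.Dart → ℝ}
    (hz : z ∈ feasibleLinkFlows 𝒩) : ∃ g ∈ pathFlows 𝒩, linkFlow 𝒩 g = z := by
  classical
  obtain ⟨-, f, hf, rfl⟩ := hz
  refine ⟨fun r s => if (r, s) ∈ odPairs 𝒩 then f r s else 0, fun r s => ?_,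
    linkFlow_congr fun r s h => if_pos h⟩
  by_cases h : (r, s) ∈ odPairs 𝒩
  · simpa only [if_pos h] using hf r s h
  · have h0 : 𝒩.demand r s = 0 := le_antisymm (not_lt.1 h) (𝒩.demand_nonneg r s)
    simp [if_neg h, h0]

theorem sum_mul_linkFlow (𝒩 : Network G) (t : G.Dart → ℝ) (f : ∀ r s : V, G.Path r s → ℝ) :
    open Classical in
    ∑ a, t a * linkFlow 𝒩 f a =
      ∑ w : V × V with w ∈ odPairs 𝒩, ∑ p : G.Path w.1 w.2,
        f w.1 w.2 p * ∑ a, incidence a p * t a := by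
  classical
  simp only [linkFlow, Finset.mul_sum]
  rw [Finset.sum_comm]
  refine Finset.sum_congr rfl fun w _ => ?_
  rw [Finset.sum_comm]
  exact Finset.sum_congr rfl fun p _ => Finset.sum_congr rfl fun a _ => by ring

end PathFlows

/-! ### The variational inequality and Wardrop's principle -/

section Equilibrium

variable {V : Type*} {G : SimpleGraph V} [Fintype V] [DecidableEq V] [DecidableRel G.Adj]

/-- A minimiser of the Beckmann potential over the feasible link flows solves the variational
inequality of the mean travel times. -/
theorem exists_variationalInequality (𝒩 : Network G) (θ : Params)
    (hconn : ∀ r s, (r, s) ∈ odPairs 𝒩 → G.Reachable r s) :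
    ∃ f, IsFeasiblePathFlow 𝒩 f ∧ ∀ z ∈ feasibleLinkFlows 𝒩,
      0 ≤ ∑ a, meanTime 𝒩 θ a (linkFlow 𝒩 f a) (linkFlow 𝒩 f a.symm) *
        (z a - linkFlow 𝒩 f a) := by
  obtain ⟨f, hf, hmin⟩ := (isCompact_pathFlows 𝒩).exists_isMinOn (pathFlows_nonempty 𝒩 hconn)
    ((continuous_beckmann 𝒩 θ).comp (continuous_linkFlow 𝒩)).continuousOn
  refine ⟨f, isFeasiblePathFlow_of_mem_pathFlows hf, fun z hz => ?_⟩
  obtain ⟨g, hg, rfl⟩ := exists_mem_pathFlows_linkFlow_eq hz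
  have hd := (hasDerivAt_beckmann_line 𝒩 θ (linkFlow 𝒩 f)
    (linkFlow 𝒩 g - linkFlow 𝒩 f)).tendsto_slope_zero_right
  refine ge_of_tendsto hd ?_
  filter_upwards [Ioc_mem_nhdsGT (zero_lt_one' ℝ)] with ε hε
  have hmem : (1 - ε) • f + ε • g ∈ pathFlows 𝒩 :=
    convex_pathFlows 𝒩 hf hg (by linarith [hε.2]) hε.1.le (by ring)
  have heq : linkFlow 𝒩 ((1 - ε) • f + ε • g) =
      linkFlow 𝒩 f + ε • (linkFlow 𝒩 g - linkFlow 𝒩 f) := by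
    rw [linkFlow_add, linkFlow_smul, linkFlow_smul]
    module
  have hle : beckmann 𝒩 θ (linkFlow 𝒩 f) ≤ beckmann 𝒩 θ (linkFlow 𝒩 ((1 - ε) • f + ε • g)) :=
    hmin hmem
  rw [heq] at hle
  refine smul_nonneg (inv_nonneg.2 hε.1.le) ?_
  simpa using hle

/-- For any link times `t`, a path flow that solves the variational inequality uses only paths of
minimal total time. -/
theorem pathTime_le_of_variationalInequality {𝒩 : Network G} {t : G.Dart → ℝ}
    {f : ∀ r s : V, G.Path r s → ℝ} (hf : IsFeasiblePathFlow 𝒩 f)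
    (hVI : ∀ z ∈ feasibleLinkFlows 𝒩, 0 ≤ ∑ a, t a * (z a - linkFlow 𝒩 f a))
    {r s : V} (hrs : (r, s) ∈ odPairs 𝒩) (p p' : G.Path r s) (hp : 0 < f r s p) :
    ∑ a, incidence a p * t a ≤ ∑ a, incidence a p' * t a := by
  classical
  -- The direction that moves the flow on `p` to `p'`.
  let d : ∀ u v : V, G.Path u v → ℝ := Function.update 0 r (Function.update 0 s
    (Pi.single p' (f r s p) - Pi.single p (f r s p)))
  have hd_self : d r s = Pi.single p' (f r s p) - Pi.single p (f r s p) := by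
    simp only [d, Function.update_self]
  have hd_other : ∀ u v, (u, v) ≠ (r, s) → d u v = 0 := by
    intro u v huv
    by_cases hu : u = r
    · subst hu
      have hv : v ≠ s := fun h => huv (by rw [h])
      simp only [d, Function.update_self, Function.update_of_ne hv, Pi.zero_apply]
    · simp only [d, Function.update_of_ne hu, Pi.zero_apply]
  have hfeas : IsFeasiblePathFlow 𝒩 (f + d) := by
    intro u v huv
    by_cases h : (u, v) = (r, s)
    · obtain ⟨rfl, rfl⟩ := Prod.mk.inj h
      simp only [Pi.add_apply, hd_self, Pi.sub_apply]
      refine ⟨fun q => ?_, ?_⟩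
      · have h1 : 0 ≤ (Pi.single p' (f u v p) : G.Path u v → ℝ) q :=
          (Pi.single_nonneg (α := fun _ => ℝ)).2 hp.le q
        by_cases hq : q = p
        · subst hq
          rw [Pi.single_eq_same]
          linarith
        · rw [Pi.single_eq_of_ne hq]
          linarith [(hf u v huv).1 q]
      · rw [Finset.sum_add_distrib, Finset.sum_sub_distrib, Fintype.sum_pi_single',
          Fintype.sum_pi_single', sub_self, add_zero, (hf u v huv).2]
    · simpa only [Pi.add_apply, hd_other u v h, Pi.zero_apply, add_zero] using hf u v huv
  have key := hVI _ (linkFlow_mem_feasibleLinkFlows hfeas)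
  simp only [linkFlow_add, Pi.add_apply, add_sub_cancel_left] at key
  rw [sum_mul_linkFlow, Finset.sum_eq_single (r, s)] at key
  · simp only [hd_self, Pi.sub_apply, sub_mul, Finset.sum_sub_distrib, Pi.single_apply, ite_mul,
      zero_mul, Finset.sum_ite_eq', Finset.mem_univ, if_true, ← mul_sub] at key
    exact sub_nonneg.1 (nonneg_of_mul_nonneg_right key hp)
  · intro w _ hw
    simp only [hd_other w.1 w.2 hw, Pi.zero_apply, zero_mul, Finset.sum_const_zero]
  · intro h
    exact absurd (Finset.mem_filter.2 ⟨Finset.mem_univ _, hrs⟩) h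

end Equilibrium

/-! ### Expected travel times -/

section Expectation

variable {V : Type*} {G : SimpleGraph V} {𝒩 : Network G} {θ : Params}
  {S : Type*} [MeasurableSpace S] {P : Measure S} {T : G.Dart → ℝ → ℝ → S → ℝ}

theorem IsStochasticSymmetricPVDF.integral_eq (hT : IsStochasticSymmetricPVDF 𝒩 θ P T)
    (a : G.Dart) {x y : ℝ} (hx : 0 ≤ x) (hy : 0 ≤ y) :
    ∫ ω, T a x y ω ∂P = meanTime 𝒩 θ a x y := by
  rw [(hT a x y hx hy).integral_eq, integral_logNormal (meanTime_pos 𝒩 θ a hx hy)]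

theorem IsStochasticSymmetricPVDF.integrable (hT : IsStochasticSymmetricPVDF 𝒩 θ P T)
    (a : G.Dart) {x y : ℝ} (hx : 0 ≤ x) (hy : 0 ≤ y) : Integrable (T a x y) P := by
  -- The integral of a non-integrable function is `0`, whereas the mean is positive.
  by_contra h
  have h0 := hT.integral_eq a hx hy
  rw [integral_undef h] at h0
  exact (meanTime_pos 𝒩 θ a hx hy).ne h0

variable [Fintype V] [DecidableEq V] [DecidableRel G.Adj]

theorem IsStochasticSymmetricPVDF.expectedPathTime_eq (hT : IsStochasticSymmetricPVDF 𝒩 θ P T)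
    {x : G.Dart → ℝ} (hx : ∀ a, 0 ≤ x a) {r s : V} (p : G.Path r s) :
    expectedPathTime P T x p = ∑ a, incidence a p * meanTime 𝒩 θ a (x a) (x a.symm) := by
  unfold expectedPathTime
  rw [integral_finsetSum _ fun a _ => (hT.integrable a (hx a) (hx a.symm)).const_mul _]
  simp only [integral_const_mul, hT.integral_eq _ (hx _) (hx _)]

end Expectation

end PTAP

theorem mainTheorem1 {V : Type*} [Fintype V] [DecidableEq V]
    (G : SimpleGraph V) [DecidableRel G.Adj]
    (𝒩 : PTAP.Network G) (θ : PTAP.Params)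
    (hconn : ∀ r s, (r, s) ∈ PTAP.odPairs 𝒩 → G.Reachable r s)
    {S : Type*} [MeasurableSpace S] (P : MeasureTheory.Measure S)
    [MeasureTheory.IsProbabilityMeasure P]
    (T : G.Dart → ℝ → ℝ → S → ℝ) (hT : PTAP.IsStochasticSymmetricPVDF 𝒩 θ P T)
    (hcont : ∀ a, ContinuousOn (fun z : ℝ × ℝ => PTAP.meanTime 𝒩 θ a z.1 z.2)
      (Set.Ici 0 ×ˢ Set.Ici 0))
    (hC2 : ∀ a, ContDiffOn ℝ 2 (fun z : ℝ × ℝ => PTAP.meanTime 𝒩 θ a z.1 z.2)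
      (Set.Ioi 0 ×ˢ Set.Ioi 0)) :
    ∃ f : ∀ r s : V, G.Path r s → ℝ,
      PTAP.SolvesVI 𝒩 P T (PTAP.linkFlow 𝒩 f) ∧ PTAP.IsWardropEquilibrium 𝒩 P T f := by
  obtain ⟨f, hf, hVI⟩ := PTAP.exists_variationalInequality 𝒩 θ hconn
  have hx := PTAP.linkFlow_nonneg hf
  refine ⟨f, ⟨PTAP.linkFlow_mem_feasibleLinkFlows hf, fun z hz => ?_⟩, hf,
    fun r s hrs p p' hp => ?_⟩
  · simpa only [PTAP.expectedTime, hT.integral_eq _ (hx _) (hx _)] using hVI z hz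
  · rw [hT.expectedPathTime_eq hx, hT.expectedPathTime_eq hx]
    exact PTAP.pathTime_le_of_variationalInequality hf hVI hrs p p' hp
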